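/- Let $N\ge 1$ be an integer, let $A\subseteq\{1,2,\dots,2N-1\}$, and let $n\ge 0$ be an integer. Let $c_1(A;n,2N)$ be the number of partitions of $n$ such that 1. each part is congruent modulo $2N$ to $0$ or to some element of $A$; 2. only multiples of $N$ can be repeated; 3. the difference between any two successive parts (in nonincreasing order) is at most $2N$, and is strictly less than $2N$ if either of the two parts is divisible by $N$; 4. the smallest part is less than $2N$ (no condition for the empty partition of $0$). Let $c_2(A;n,2N)$ be the number of partitions of $n$ such that each part is congruent modulo $2N$ to some element of $A$ and only multiples of $N$ can be repeated. Then $$c_1(A;n,2N)=c_2(A;n,2N).$$ -/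

import Mathlib

/-- The parts of the partition `p`, listed in nonincreasing order. -/
def Nat.Partition.sortedParts {n : ℕ} (p : n.Partition) : List ℕ :=
  p.parts.sort (· ≥ ·)

/-- The set `C₁(A; n, 2N)` of partitions of `n`. -/
def partitionsC1 (A : Finset ℕ) (n N : ℕ) : Set n.Partition :=
  {p | -- each part is congruent to `0` or to some element of `A` modulo `2N`
    (∀ x ∈ p.parts, x ≡ 0 [MOD 2 * N] ∨ ∃ a ∈ A, x ≡ a [MOD 2 * N]) ∧
    -- only multiples of `N` can be repeated
    (∀ x ∈ p.parts, 1 < p.parts.count x → N ∣ x) ∧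
    -- successive parts `x ≥ y` satisfy `x - y ≤ 2N`, strictly if either is divisible by `N`
    p.sortedParts.IsChain
      (fun x y => x ≤ y + 2 * N ∧ (N ∣ x ∨ N ∣ y → x < y + 2 * N)) ∧
    -- the smallest part (if there is any part) is less than `2N`
    (∀ x ∈ p.parts, (∀ y ∈ p.parts, x ≤ y) → x < 2 * N)}

/-- The set `C₂(A; n, 2N)` of partitions of `n`. -/
def partitionsC2 (A : Finset ℕ) (n N : ℕ) : Set n.Partition :=
  {p | -- each part is congruent to some element of `A` modulo `2N`
    (∀ x ∈ p.parts, ∃ a ∈ A, x ≡ a [MOD 2 * N]) ∧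
    -- only multiples of `N` can be repeated
    (∀ x ∈ p.parts, 1 < p.parts.count x → N ∣ x)}

/-- The number `c₁(A; n, 2N)`. -/
noncomputable def c1 (A : Finset ℕ) (n N : ℕ) : ℕ :=
  (partitionsC1 A n N).ncard

/-- The number `c₂(A; n, 2N)`. -/
noncomputable def c2 (A : Finset ℕ) (n N : ℕ) : ℕ :=
  (partitionsC2 A n N).ncard

/-!
Call a partition *admissible* if its parts have residue in `A ∪ {0}` modulo `2N` and only multiples
of `N` are repeated. Both `partitionsC1` and `partitionsC2` become the admissible partitions after
they are paired with arbitrary partitions whose parts are multiplied by `2N`.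

* `bijOn_add_map`: an admissible partition is, uniquely, the union of its parts not divisible by
  `2N`, which form an element of `partitionsC2`, and its multiples of `2N`.
* `bijOn_partSeq_add`: pad the sorted parts of an admissible partition by infinitely many zeros, and
  shrink every gap by multiples of `2N` as far as admissibility permits. What remains is the unique
  sequence with the same residues and small gaps, an element of `partitionsC1`, and what is removed
  is `2N` times a nonincreasing sequence, that is, `2N` times a partition added part by part. The
  bound on the smallest part in `partitionsC1` is the gap condition towards the first padding zero.
  Existence is `exists_smallGap_add_smul` and uniqueness is `eq_of_smallGap_of_modEq`.

Thus the two counts, as functions of `n`, have the same convolution with the number of partitions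
into multiples of `2N`. As the latter is `1` at `0`, it can be cancelled
(`ncard_eq_of_ncard_pairs_eq`).
-/

/-! ### Cancelling a common factor of a convolution -/

/-- Counting pairs by total weight is convolution of the counts by weight. -/
theorem ncard_pairs_eq_sum_antidiagonal {α β : Type*} (X : Set α) (Z : Set β) (w : α → ℕ)
    (v : β → ℕ) (hX : ∀ i, {x | x ∈ X ∧ w x = i}.Finite)
    (hZ : ∀ i, {z | z ∈ Z ∧ v z = i}.Finite) (n : ℕ) :
    {q : α × β | (q.1 ∈ X ∧ q.2 ∈ Z) ∧ w q.1 + v q.2 = n}.ncard =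
      ∑ ij ∈ Finset.HasAntidiagonal.antidiagonal n,
        {x | x ∈ X ∧ w x = ij.1}.ncard * {z | z ∈ Z ∧ v z = ij.2}.ncard := by
  classical
  have hU : {q : α × β | (q.1 ∈ X ∧ q.2 ∈ Z) ∧ w q.1 + v q.2 = n} =
      ⋃ ij ∈ Finset.HasAntidiagonal.antidiagonal n,
        {x | x ∈ X ∧ w x = ij.1} ×ˢ {z | z ∈ Z ∧ v z = ij.2} := by
    ext ⟨x, z⟩
    simp only [Set.mem_ofPred_eq, Set.mem_iUnion,
      Finset.HasAntidiagonal.mem_antidiagonal, Set.mem_prod, exists_prop, Prod.exists]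
    grind
  have hfin : {q : α × β | (q.1 ∈ X ∧ q.2 ∈ Z) ∧ w q.1 + v q.2 = n}.Finite := by
    rw [hU]
    exact Set.Finite.biUnion (Finset.finite_toSet _) fun ij _ => (hX _).prod (hZ _)
  rw [Set.ncard_eq_toFinset_card _ hfin,
    Finset.card_eq_sum_card_fiberwise (f := fun q : α × β => (w q.1, v q.2))
      (t := Finset.HasAntidiagonal.antidiagonal n)]
  · refine Finset.sum_congr rfl fun ij hij => ?_
    rw [← Set.ncard_prod, ← Set.ncard_coe_finset]
    congr 1
    ext ⟨x, z⟩
    simp only [Finset.HasAntidiagonal.mem_antidiagonal] at hij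
    simp only [Finset.coe_filter, Set.Finite.mem_toFinset, Set.mem_ofPred_eq, Set.mem_prod,
      Prod.ext_iff]
    grind
  · intro q hq
    simpa using ((Set.Finite.mem_toFinset hfin).1 hq).2

/-- If pairing with a family `Z` that has exactly one element of weight `0` makes the weighted
families `X` and `Y` equinumerous, then they already are. -/
theorem ncard_eq_of_ncard_pairs_eq {α β γ : Type*} (X : Set α) (Y : Set γ) (Z : Set β) (w : α → ℕ)
    (w' : γ → ℕ) (v : β → ℕ) (hX : ∀ i, {x | x ∈ X ∧ w x = i}.Finite)
    (hY : ∀ i, {y | y ∈ Y ∧ w' y = i}.Finite) (hZ : ∀ i, {z | z ∈ Z ∧ v z = i}.Finite)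
    (hZ0 : {z | z ∈ Z ∧ v z = 0}.ncard = 1)
    (h : ∀ n, {q : α × β | (q.1 ∈ X ∧ q.2 ∈ Z) ∧ w q.1 + v q.2 = n}.ncard =
      {q : γ × β | (q.1 ∈ Y ∧ q.2 ∈ Z) ∧ w' q.1 + v q.2 = n}.ncard) (n : ℕ) :
    {x | x ∈ X ∧ w x = n}.ncard = {y | y ∈ Y ∧ w' y = n}.ncard := by
  induction n using Nat.strong_induction_on with
  | _ n ih =>
    have hmem : (n, 0) ∈ Finset.HasAntidiagonal.antidiagonal n := by simp
    have key := h n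
    rw [ncard_pairs_eq_sum_antidiagonal X Z w v hX hZ,
      ncard_pairs_eq_sum_antidiagonal Y Z w' v hY hZ,
      ← Finset.add_sum_erase _ _ hmem, ← Finset.add_sum_erase _ _ hmem] at key
    rw [Finset.sum_congr rfl (g := fun ij : ℕ × ℕ =>
      {y | y ∈ Y ∧ w' y = ij.1}.ncard * {z | z ∈ Z ∧ v z = ij.2}.ncard)] at key
    · simpa [hZ0] using key
    · rintro ⟨i, j⟩ hij
      simp only [Finset.mem_erase, ne_eq, Prod.mk.injEq,
        Finset.HasAntidiagonal.mem_antidiagonal] at hij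
      rw [ih i (by omega)]

/-! ### Partitions as nonincreasing sequences -/

/-- The parts of a multiset in nonincreasing order, padded with infinitely many zeros. -/
noncomputable def partSeq (s : Multiset ℕ) : ℕ →₀ ℕ :=
  (s.sort (· ≥ ·)).toFinsupp

/-- The multiset of nonzero values of a finitely supported sequence. -/
noncomputable def partsOf (f : ℕ →₀ ℕ) : Multiset ℕ :=
  f.support.val.map f

theorem partSeq_apply (s : Multiset ℕ) (i : ℕ) : partSeq s i = (s.sort (· ≥ ·)).getD i 0 := by
  rw [partSeq, List.toFinsupp_apply]

theorem partSeq_of_lt {s : Multiset ℕ} {i : ℕ} (hi : i < (s.sort (· ≥ ·)).length) :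
    partSeq s i = (s.sort (· ≥ ·))[i] := by
  rw [partSeq_apply, List.getD_eq_getElem]

theorem partSeq_of_le {s : Multiset ℕ} {i : ℕ} (hi : (s.sort (· ≥ ·)).length ≤ i) :
    partSeq s i = 0 := by
  rw [partSeq_apply, List.getD_eq_default _ _ hi]

theorem partSeq_antitone (s : Multiset ℕ) : Antitone (partSeq s) := by
  refine antitone_nat_of_succ_le fun i => ?_
  rcases lt_or_ge (i + 1) (s.sort (· ≥ ·)).length with h | h
  · rw [partSeq_of_lt h, partSeq_of_lt (by omega)]
    exact List.pairwise_iff_getElem.1 (s.pairwise_sort (· ≥ ·)) _ _ _ _ (Nat.lt_succ_self i)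
  · rw [partSeq_of_le h]
    exact Nat.zero_le _

theorem partSeq_mem {s : Multiset ℕ} {i : ℕ} (h : partSeq s i ≠ 0) : partSeq s i ∈ s := by
  have hi : i < (s.sort (· ≥ ·)).length := by
    by_contra hi
    exact h (partSeq_of_le (not_lt.1 hi))
  rw [partSeq_of_lt hi, ← Multiset.mem_sort (· ≥ ·)]
  exact List.getElem_mem hi

theorem exists_partSeq_eq {s : Multiset ℕ} {x : ℕ} (h : x ∈ s) :
    ∃ i, ∃ _ : i < (s.sort (· ≥ ·)).length, partSeq s i = x := by
  rw [← Multiset.mem_sort (· ≥ ·)] at h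
  obtain ⟨i, hi, rfl⟩ := List.mem_iff_getElem.1 h
  exact ⟨i, hi, partSeq_of_lt hi⟩

theorem zero_notMem_partsOf (f : ℕ →₀ ℕ) : 0 ∉ partsOf f := by
  simp [partsOf]

theorem sum_partsOf (f : ℕ →₀ ℕ) : (partsOf f).sum = f.degree := by
  rw [Finsupp.degree_apply]
  rfl

theorem partsOf_partSeq {s : Multiset ℕ} (hs : 0 ∉ s) : partsOf (partSeq s) = s := by
  have hsupp : (partSeq s).support = Finset.range (s.sort (· ≥ ·)).length := by
    ext i
    rw [Finsupp.mem_support_iff, Finset.mem_range]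
    constructor
    · intro h
      by_contra hi
      exact h (partSeq_of_le (not_lt.1 hi))
    · intro hi h
      rw [partSeq_of_lt hi] at h
      refine hs ?_
      rw [← h, ← Multiset.mem_sort (· ≥ ·)]
      exact List.getElem_mem hi
  conv_rhs => rw [← s.sort_eq (· ≥ ·)]
  rw [partsOf, hsupp, Finset.range_val, ← Multiset.coe_range, Multiset.map_coe]
  congr 1
  refine List.ext_getElem (by simp) fun i h₁ h₂ => ?_
  simp [partSeq_of_lt h₂]

theorem partSeq_partsOf {f : ℕ →₀ ℕ} (hf : Antitone f) : partSeq (partsOf f) = f := by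
  obtain ⟨K, hK⟩ : ∃ K, f.support = Finset.range K := by
    have hex : ∃ k, f k = 0 := by
      obtain ⟨k, hk⟩ := Infinite.exists_notMem_finset f.support
      exact ⟨k, Finsupp.notMem_support_iff.1 hk⟩
    classical
    refine ⟨Nat.find hex, ?_⟩
    ext i
    rw [Finsupp.mem_support_iff, Finset.mem_range]
    constructor
    · intro h
      by_contra hi
      have := hf (not_lt.1 hi)
      have := Nat.find_spec hex
      omega
    · exact fun h => Nat.find_min hex h
  have hsort : (partsOf f).sort (· ≥ ·) = (List.range K).map f := by
    refine List.Perm.eq_of_pairwise (le := (· ≥ ·)) (fun a b _ _ h h' => le_antisymm h' h)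
      (Multiset.pairwise_sort _ _) ?_ ?_
    · rw [List.pairwise_iff_getElem]
      intro i j hi hj hij
      simpa using hf hij.le
    · rw [← Multiset.coe_eq_coe, Multiset.sort_eq, partsOf, hK, Finset.range_val,
        ← Multiset.coe_range, Multiset.map_coe]
  ext i
  rw [partSeq_apply, hsort]
  rcases lt_or_ge i K with h | h
  · rw [List.getD_eq_getElem _ _ (by simpa using h)]
    simp
  · rw [List.getD_eq_default _ _ (by simpa using h)]
    have : i ∉ f.support := by simp [hK, h]
    exact (Finsupp.notMem_support_iff.1 this).symm

theorem degree_partSeq {s : Multiset ℕ} (hs : 0 ∉ s) : (partSeq s).degree = s.sum := by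
  rw [← sum_partsOf, partsOf_partSeq hs]

theorem forall_mem_iff_forall_partSeq {s : Multiset ℕ} {P : ℕ → Prop} (hP : P 0) :
    (∀ x ∈ s, P x) ↔ ∀ i, P (partSeq s i) := by
  constructor
  · intro h i
    by_cases hi : partSeq s i = 0
    · rwa [hi]
    · exact h _ (partSeq_mem hi)
  · intro h x hx
    obtain ⟨i, _, rfl⟩ := exists_partSeq_eq hx
    exact h i

theorem forall_repeated_iff {s : Multiset ℕ} {N : ℕ} :
    (∀ x ∈ s, 1 < s.count x → N ∣ x) ↔
      ∀ i, partSeq s i = partSeq s (i + 1) → N ∣ partSeq s i := by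
  have hdup (x : ℕ) : 1 < s.count x ↔ List.Duplicate x (s.sort (· ≥ ·)) := by
    rw [List.duplicate_iff_two_le_count, ← Multiset.coe_count, Multiset.sort_eq]
    rfl
  constructor
  · intro h i hi
    by_cases h0 : partSeq s i = 0
    · simp [h0]
    have hlt : i + 1 < (s.sort (· ≥ ·)).length := by
      by_contra hlt
      exact h0 (hi.trans (partSeq_of_le (not_lt.1 hlt)))
    refine h _ (partSeq_mem h0) ((hdup _).2 ?_)
    rw [List.duplicate_iff_exists_distinct_get]
    refine ⟨⟨i, by omega⟩, ⟨i + 1, hlt⟩, by simp [Fin.lt_def], ?_, ?_⟩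
    · exact partSeq_of_lt _
    · exact hi.trans (partSeq_of_lt _)
  · intro h x _ hc
    rw [hdup, List.duplicate_iff_exists_distinct_get] at hc
    obtain ⟨i, j, hij, hi, hj⟩ := hc
    replace hi : x = partSeq s i := hi.trans (partSeq_of_lt i.2).symm
    replace hj : x = partSeq s j := hj.trans (partSeq_of_lt j.2).symm
    rw [hi]
    refine h _ (le_antisymm ?_ (partSeq_antitone s (Nat.le_succ _)))
    rw [← hi, hj]
    exact partSeq_antitone s (Nat.succ_le_of_lt hij)

/-! ### The three families of partitions -/

/-- The multisets of positive integers. -/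
def posMultisets : Set (Multiset ℕ) := {s | 0 ∉ s}

/-- The partitions whose parts have residue in `A ∪ {0}` modulo `2N` and in which only multiples
of `N` are repeated. -/
def admissible (A : Finset ℕ) (N : ℕ) : Set (Multiset ℕ) :=
  {s | 0 ∉ s ∧ (∀ x ∈ s, x ≡ 0 [MOD 2 * N] ∨ ∃ a ∈ A, x ≡ a [MOD 2 * N]) ∧
    ∀ x ∈ s, 1 < s.count x → N ∣ x}

/-- The condition on consecutive parts `x ≥ y` in `partitionsC1`. -/
def SmallGap (N x y : ℕ) : Prop :=
  x ≤ y + 2 * N ∧ (N ∣ x ∨ N ∣ y → x < y + 2 * N)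

/-- The admissible partitions all of whose gaps are small. The gap between the smallest part and
the zero that follows it is included, which encodes the bound on the smallest part. -/
def smallGapPartitions (A : Finset ℕ) (N : ℕ) : Set (Multiset ℕ) :=
  {s | s ∈ admissible A N ∧ ∀ i, SmallGap N (partSeq s i) (partSeq s (i + 1))}

/-- The partitions whose parts have residue in `A` modulo `2N` and in which only multiples of `N`
are repeated. -/
def nonzeroResiduePartitions (A : Finset ℕ) (N : ℕ) : Set (Multiset ℕ) :=
  {s | 0 ∉ s ∧ (∀ x ∈ s, ∃ a ∈ A, x ≡ a [MOD 2 * N]) ∧ ∀ x ∈ s, 1 < s.count x → N ∣ x}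

/-- The chain condition on the parts together with the bound on the smallest part says that all
gaps of the padded sequence are small: the zero after the smallest part is a multiple of `N`, so
the gap to it must be strictly less than `2N`. -/
theorem isChain_and_smallest_iff {s : Multiset ℕ} (N : ℕ) (hN : 1 ≤ N) :
    ((s.sort (· ≥ ·)).IsChain (fun x y => x ≤ y + 2 * N ∧ (N ∣ x ∨ N ∣ y → x < y + 2 * N)) ∧
      ∀ x ∈ s, (∀ y ∈ s, x ≤ y) → x < 2 * N) ↔
    ∀ i, SmallGap N (partSeq s i) (partSeq s (i + 1)) := by
  rw [List.isChain_iff_getElem]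
  constructor
  · rintro ⟨h, hmin⟩ i
    rcases lt_trichotomy (i + 1) (s.sort (· ≥ ·)).length with hi | hi | hi
    · rw [partSeq_of_lt hi, partSeq_of_lt (by omega)]
      exact h i hi
    · have hlt : partSeq s i < 2 * N := by
        by_cases h0 : partSeq s i = 0
        · omega
        refine hmin _ (partSeq_mem h0) fun y hy => ?_
        obtain ⟨j, hj, rfl⟩ := exists_partSeq_eq hy
        exact partSeq_antitone s (by omega)
      rw [partSeq_of_le (i := i + 1) hi.ge]
      exact ⟨by omega, fun _ => by omega⟩
    · rw [partSeq_of_le (i := i + 1) (by omega), partSeq_of_le (i := i) (by omega)]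
      exact ⟨by omega, fun _ => by omega⟩
  · refine fun h => ⟨fun i hi => ?_, fun x hx hmin => ?_⟩
    · have := h i
      rwa [partSeq_of_lt hi, partSeq_of_lt (by omega)] at this
    · obtain ⟨i, hi, rfl⟩ := exists_partSeq_eq hx
      set L := (s.sort (· ≥ ·)).length with hL
      have hlast : L - 1 < (s.sort (· ≥ ·)).length := by omega
      have hle : partSeq s i ≤ partSeq s (L - 1) := by
        refine hmin _ ?_
        rw [partSeq_of_lt hlast, ← Multiset.mem_sort (· ≥ ·)]
        exact List.getElem_mem hlast
      have hgap := (h (L - 1)).2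
      rw [partSeq_of_le (i := L - 1 + 1) (by omega)] at hgap
      have := hgap (Or.inr (dvd_zero N))
      omega

/-- Counting partitions of `n` is the same as counting multisets of positive integers with
sum `n`. -/
theorem ncard_partitions_eq {n : ℕ} (S : Set n.Partition) (X : Set (Multiset ℕ))
    (h0 : ∀ s ∈ X, 0 ∉ s) (h : ∀ p : n.Partition, p ∈ S ↔ p.parts ∈ X) :
    S.ncard = {s | s ∈ X ∧ s.sum = n}.ncard := by
  refine Set.BijOn.ncard_eq (f := Nat.Partition.parts) ⟨?_, ?_, ?_⟩
  · exact fun p hp => ⟨(h p).1 hp, p.parts_sum⟩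
  · exact fun p _ q _ hpq => Nat.Partition.ext hpq
  · rintro s ⟨hs, hsum⟩
    let p : n.Partition := ⟨s, fun {i} hi =>
      Nat.pos_of_ne_zero fun hi0 => h0 s hs (hi0 ▸ hi), hsum⟩
    exact ⟨p, (h p).2 hs, rfl⟩

theorem finite_sum_eq (X : Set (Multiset ℕ)) (h0 : ∀ s ∈ X, 0 ∉ s) (n : ℕ) :
    {s | s ∈ X ∧ s.sum = n}.Finite := by
  refine (Set.finite_range (Nat.Partition.parts (n := n))).subset ?_
  rintro s ⟨hs, hsum⟩
  exact ⟨⟨s, fun {i} hi => Nat.pos_of_ne_zero fun hi0 => h0 s hs (hi0 ▸ hi), hsum⟩, rfl⟩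

theorem c1_eq_ncard (A : Finset ℕ) (n N : ℕ) (hN : 1 ≤ N) :
    c1 A n N = {s | s ∈ smallGapPartitions A N ∧ s.sum = n}.ncard := by
  refine ncard_partitions_eq _ _ (fun s hs => hs.1.1) fun p => ?_
  have h0 : 0 ∉ p.parts := fun h => (p.parts_pos h).false
  simp only [partitionsC1, smallGapPartitions, admissible, Set.mem_ofPred_eq,
    Nat.Partition.sortedParts, ← isChain_and_smallest_iff N hN]
  tauto

theorem c2_eq_ncard (A : Finset ℕ) (n N : ℕ) :
    c2 A n N = {s | s ∈ nonzeroResiduePartitions A N ∧ s.sum = n}.ncard := by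
  refine ncard_partitions_eq _ _ (fun s hs => hs.1) fun p => ?_
  have h0 : 0 ∉ p.parts := fun h => (p.parts_pos h).false
  simp only [partitionsC2, nonzeroResiduePartitions, Set.mem_ofPred_eq]
  tauto

/-! ### Splitting off the multiples of the modulus -/

/-- Uniting the parts with nonzero residue with the multiples of `2N` gives every admissible
partition exactly once. -/
theorem bijOn_add_map (N : ℕ) (hN : 1 ≤ N) (A : Finset ℕ) (hA : ∀ a ∈ A, 1 ≤ a ∧ a < 2 * N)
    (n : ℕ) :
    Set.BijOn (fun q : Multiset ℕ × Multiset ℕ => q.1 + q.2.map (2 * N * ·))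
      {q | (q.1 ∈ nonzeroResiduePartitions A N ∧ q.2 ∈ posMultisets) ∧
        q.1.sum + 2 * N * q.2.sum = n}
      {s | s ∈ admissible A N ∧ s.sum = n} := by
  have hndvd {x a : ℕ} (ha : a ∈ A) (hx : x ≡ a [MOD 2 * N]) : ¬ 2 * N ∣ x := by
    intro hd
    have h1 := Nat.le_of_dvd (hA a ha).1 ((hx.dvd_iff dvd_rfl).1 hd)
    have h2 := (hA a ha).2
    omega
  have hfilter {c t : Multiset ℕ} (hc : c ∈ nonzeroResiduePartitions A N) :
      (c + t.map (2 * N * ·)).filter (2 * N ∣ ·) = t.map (2 * N * ·) ∧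
      (c + t.map (2 * N * ·)).filter (¬ 2 * N ∣ ·) = c := by
    have h1 : ∀ x ∈ c, ¬ 2 * N ∣ x := fun x hx => by
      obtain ⟨a, ha, hxa⟩ := hc.2.1 x hx
      exact hndvd ha hxa
    have h2 : ∀ x ∈ t.map (2 * N * ·), 2 * N ∣ x := by
      simp
    constructor
    · rw [Multiset.filter_add, Multiset.filter_eq_nil.2 h1, Multiset.filter_eq_self.2 h2, zero_add]
    · rw [Multiset.filter_add, Multiset.filter_eq_self.2 h1,
        Multiset.filter_eq_nil.2 fun x hx => not_not.2 (h2 x hx), add_zero]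
  refine ⟨?_, ?_, ?_⟩
  · rintro ⟨c, t⟩ ⟨⟨hc, ht⟩, hsum⟩
    simp only at hc ht hsum
    refine ⟨⟨?_, ?_, ?_⟩, ?_⟩
    · simp only [Multiset.mem_add, Multiset.mem_map, not_or, not_exists, not_and]
      refine ⟨hc.1, fun x hx h => ht ?_⟩
      have : x = 0 := by
        rcases Nat.mul_eq_zero.1 h with h | h <;> omega
      rwa [← this]
    · intro x hx
      rcases Multiset.mem_add.1 hx with hx | hx
      · exact Or.inr (hc.2.1 x hx)
      · obtain ⟨y, _, rfl⟩ := Multiset.mem_map.1 hx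
        exact Or.inl (Nat.modEq_zero_iff_dvd.2 (dvd_mul_right _ _))
    · intro x hx hcount
      by_cases hd : 2 * N ∣ x
      · exact (dvd_mul_left N 2).trans hd
      · have hxc : x ∈ c := by
          rw [← (hfilter (t := t) hc).2]
          exact Multiset.mem_filter.2 ⟨hx, hd⟩
        refine hc.2.2 x hxc ?_
        rwa [← (hfilter (t := t) hc).2, Multiset.count_filter, if_pos hd]
    · rw [← hsum, Multiset.sum_add, Multiset.sum_map_mul_left, Multiset.map_id']
  · rintro ⟨c, t⟩ ⟨⟨hc, ht⟩, _⟩ ⟨c', t'⟩ ⟨⟨hc', ht'⟩, _⟩ h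
    simp only at h hc hc'
    have h1 := (hfilter (t := t) hc).1
    have h2 := (hfilter (t := t) hc).2
    rw [h, (hfilter hc').1] at h1
    rw [h, (hfilter hc').2] at h2
    have hinj : Function.Injective (2 * N * · : ℕ → ℕ) :=
      fun x y hxy => Nat.eq_of_mul_eq_mul_left (by omega) hxy
    exact Prod.ext h2.symm (Multiset.map_injective hinj h1.symm)
  · rintro s ⟨⟨hs0, hres, hrep⟩, hsum⟩
    have hback : ((s.filter (2 * N ∣ ·)).map (· / (2 * N))).map (2 * N * ·) =
        s.filter (2 * N ∣ ·) := by
      rw [Multiset.map_map]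
      conv_rhs => rw [← Multiset.map_id (s.filter (2 * N ∣ ·))]
      refine Multiset.map_congr rfl fun x hx => ?_
      exact Nat.mul_div_cancel' (Multiset.mem_filter.1 hx).2
    have hadd : s.filter (¬ 2 * N ∣ ·) +
        ((s.filter (2 * N ∣ ·)).map (· / (2 * N))).map (2 * N * ·) = s := by
      rw [hback, add_comm, Multiset.filter_add_not]
    refine ⟨(s.filter (¬ 2 * N ∣ ·), (s.filter (2 * N ∣ ·)).map (· / (2 * N))),
      ⟨⟨⟨?_, ?_, ?_⟩, ?_⟩, ?_⟩, hadd⟩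
    · exact fun h => hs0 (Multiset.mem_filter.1 h).1
    · intro x hx
      obtain ⟨hx, hd⟩ := Multiset.mem_filter.1 hx
      exact (hres x hx).resolve_left fun h => hd (Nat.modEq_zero_iff_dvd.1 h)
    · intro x hx hcount
      exact hrep x (Multiset.mem_filter.1 hx).1
        (hcount.trans_le (Multiset.count_le_of_le _ (Multiset.filter_le _ _)))
    · intro h
      obtain ⟨x, hx, hx0⟩ := Multiset.mem_map.1 h
      have hd := Multiset.mem_filter.1 hx
      have := Nat.mul_div_cancel' hd.2
      rw [hx0, mul_zero] at this
      exact hs0 (this ▸ hd.1)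
    · rw [← hsum]
      conv_rhs => rw [← hadd]
      simp [Multiset.sum_map_mul_left]

/-! ### Adding multiples of the modulus to the sorted parts -/

theorem exists_forall_ge_eq_zero (f : ℕ →₀ ℕ) : ∃ K, ∀ i, K ≤ i → f i = 0 := by
  refine ⟨f.support.sup id + 1, fun i hi => ?_⟩
  by_contra h
  have := Finset.le_sup (f := id) (Finsupp.mem_support_iff.2 h)
  simp only [id] at this
  omega

/-- A nonincreasing sequence with small gaps, in which only multiples of `N` are repeated, is
determined by its residues modulo `2N`. -/
theorem eq_of_smallGap_of_modEq {N : ℕ} {f g : ℕ →₀ ℕ} (hf : Antitone f) (hg : Antitone g)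
    (hf' : ∀ i, f i = f (i + 1) → N ∣ f i) (hg' : ∀ i, g i = g (i + 1) → N ∣ g i)
    (hfgap : ∀ i, SmallGap N (f i) (f (i + 1))) (hggap : ∀ i, SmallGap N (g i) (g (i + 1)))
    (hmod : ∀ i, f i ≡ g i [MOD 2 * N]) : f = g := by
  -- Two different entries above the same next entry `c` would be `c` and `c + 2N`; then `c` is
  -- repeated, hence a multiple of `N`, and the gap `2N` above it is forbidden.
  have aux : ∀ {a b c : ℕ}, c ≤ a → SmallGap N b c → (a = c → N ∣ a) → a ≡ b [MOD 2 * N] →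
      b ≤ a := by
    intro a b c hca hb ha hab
    by_contra hlt
    obtain ⟨k, hk⟩ := (Nat.modEq_iff_dvd' (by omega)).1 hab
    have hk1 : 1 ≤ k := by
      rcases Nat.eq_zero_or_pos k with rfl | hk0
      · omega
      · exact hk0
    have hle : 2 * N ≤ b - a := hk ▸ Nat.le_mul_of_pos_right _ hk1
    have hbc := hb.1
    have hac : a = c := by omega
    have := hb.2 (Or.inr (hac ▸ ha hac))
    omega
  obtain ⟨K, hK⟩ := exists_forall_ge_eq_zero f
  obtain ⟨K', hK'⟩ := exists_forall_ge_eq_zero g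
  -- Both sequences vanish eventually, so the comparison proceeds downwards from there.
  have hall (d : ℕ) : ∀ i, max K K' ≤ i + d → f i = g i := by
    induction d with
    | zero => exact fun i hi => by rw [hK i (by omega), hK' i (by omega)]
    | succ d ih =>
      intro i hi
      have hnext := ih (i + 1) (by omega)
      refine le_antisymm ?_ ?_
      · refine aux (c := f (i + 1)) ?_ (hfgap i) ?_ (hmod i).symm
        · exact hnext ▸ hg (Nat.le_succ i)
        · exact fun h => hg' i (h.trans hnext)
      · refine aux (c := g (i + 1)) ?_ (hggap i) ?_ (hmod i)
        · exact hnext ▸ hf (Nat.le_succ i)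
        · exact fun h => hf' i (h.trans hnext.symm)
  ext i
  exact hall (max K K') i (by omega)

/-- The gaps of a nonincreasing sequence can be reduced by multiples of `2N` to small gaps that
are zero only at multiples of `N`; the total reduction `2N * v` is itself nonincreasing. -/
theorem exists_smallGap_add_smul {N : ℕ} (hN : 1 ≤ N) {f : ℕ →₀ ℕ} (hf : Antitone f)
    (hf' : ∀ i, f i = f (i + 1) → N ∣ f i) :
    ∃ u v : ℕ →₀ ℕ, Antitone u ∧ Antitone v ∧ (∀ i, u i = u (i + 1) → N ∣ u i) ∧
      (∀ i, SmallGap N (u i) (u (i + 1))) ∧ f = u + (2 * N) • v := by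
  -- The gap `d` above `y = f (i + 1)` is `2N * e + r` with `r < 2N`, except that `r = 2N` is taken
  -- instead of `r = 0` when `N` does not divide the entry `f i`.
  have hstep (i : ℕ) : ∃ e r, f i = f (i + 1) + 2 * N * e + r ∧ r ≤ 2 * N ∧
      (r = 0 → N ∣ f i) ∧ (r = 2 * N → ¬ N ∣ f i) := by
    have hle := hf (Nat.le_succ i)
    have hdiv := Nat.div_add_mod (f i - f (i + 1)) (2 * N)
    have hmod := Nat.mod_lt (f i - f (i + 1)) (show 0 < 2 * N by omega)
    by_cases h : (f i - f (i + 1)) % (2 * N) = 0 ∧ ¬ N ∣ f i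
    · have hpos : f i - f (i + 1) ≠ 0 := fun h0 => h.2 (hf' i (by grind))
      obtain ⟨e, he⟩ : ∃ e, (f i - f (i + 1)) / (2 * N) = e + 1 := by
        refine Nat.exists_eq_succ_of_ne_zero fun h0 => hpos ?_
        rw [← hdiv, h0, h.1]
        simp
      refine ⟨e, 2 * N, ?_, le_rfl, by omega, fun _ => h.2⟩
      rw [he, h.1] at hdiv
      grind
    · refine ⟨(f i - f (i + 1)) / (2 * N), (f i - f (i + 1)) % (2 * N), ?_, hmod.le,
        fun h0 => by tauto, by omega⟩
      grind
  choose e r hfe hr hr0 hrN using hstep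
  obtain ⟨K, hK⟩ := exists_forall_ge_eq_zero f
  have he0 (i : ℕ) (hi : K ≤ i) : e i = 0 := by
    have h1 := hfe i
    rw [hK i hi] at h1
    have h2 : 2 * N * e i = 0 := by omega
    rcases Nat.mul_eq_zero.1 h2 with h | h <;> omega
  -- Entry `i` must go down by all the reductions of the gaps from `i` onwards.
  let v : ℕ →₀ ℕ := Finsupp.onFinset (Finset.range K) (fun i => ∑ j ∈ Finset.Ico i K, e j)
    fun i hi => by
      by_contra h
      rw [Finset.mem_range, not_lt] at h
      exact hi (by rw [Finset.Ico_eq_empty_of_le h, Finset.sum_empty])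
  have hv0 (i : ℕ) (hi : K ≤ i) : v i = 0 := by
    simp [v, Finset.Ico_eq_empty_of_le hi]
  have hv (i : ℕ) : v i = e i + v (i + 1) := by
    rcases lt_or_ge i K with hi | hi
    · exact Finset.sum_eq_sum_Ico_succ_bot hi e
    · rw [hv0 i hi, hv0 (i + 1) (by omega), he0 i hi]
  have hmulv (i : ℕ) : 2 * N * v i = 2 * N * e i + 2 * N * v (i + 1) := by
    rw [hv i, mul_add]
  have hle (d : ℕ) : ∀ i, K ≤ i + d → 2 * N * v i ≤ f i := by
    induction d with
    | zero => exact fun i hi => by simp [hv0 i hi]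
    | succ d ih =>
      intro i hi
      have := ih (i + 1) (by omega)
      have := hfe i
      have := hmulv i
      omega
  replace hle (i : ℕ) : 2 * N * v i ≤ f i := hle K i (by omega)
  let u : ℕ →₀ ℕ := f - (2 * N) • v
  have hu (i : ℕ) : f i = u i + 2 * N * v i := by
    have : u i = f i - 2 * N * v i := by simp [u]
    have := hle i
    omega
  have hgap (i : ℕ) : u i = u (i + 1) + r i := by
    have := hu i
    have := hu (i + 1)
    have := hfe i
    have := hmulv i
    omega
  have hdvd (i : ℕ) : N ∣ f i ↔ N ∣ u i := by
    rw [hu i]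
    exact (Nat.dvd_add_iff_left (Dvd.intro_left 2 rfl |>.mul_right _)).symm
  refine ⟨u, v, antitone_nat_of_succ_le fun i => by have := hgap i; omega,
    antitone_nat_of_succ_le fun i => by have := hv i; omega, fun i hi => ?_, fun i => ⟨?_, ?_⟩, ?_⟩
  · have := hgap i
    exact (hdvd i).1 (hr0 i (by omega))
  · have := hgap i
    have := hr i
    omega
  · intro hor
    have hg := hgap i
    have := hr i
    have hne : r i ≠ 2 * N := by
      intro h
      refine hrN i h ((hdvd i).2 ?_)
      rcases hor with h' | h'
      · exact h'
      · rw [hg, h]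
        exact dvd_add h' (dvd_mul_left N 2)
    omega
  · ext i
    simpa using hu i

/-- The padding zeros satisfy the conditions on residues and on repetition, so admissibility can be
tested on the padded sequence. -/
theorem mem_admissible_iff {A : Finset ℕ} {N : ℕ} {s : Multiset ℕ} :
    s ∈ admissible A N ↔ 0 ∉ s ∧
      (∀ i, partSeq s i ≡ 0 [MOD 2 * N] ∨ ∃ a ∈ A, partSeq s i ≡ a [MOD 2 * N]) ∧
      ∀ i, partSeq s i = partSeq s (i + 1) → N ∣ partSeq s i := by
  rw [← forall_repeated_iff, ← forall_mem_iff_forall_partSeq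
    (P := fun x => x ≡ 0 [MOD 2 * N] ∨ ∃ a ∈ A, x ≡ a [MOD 2 * N]) (Or.inl rfl)]
  rfl

/-- Adding `2N` times an arbitrary partition to a partition with small gaps, part by part in sorted
order, gives every admissible partition exactly once. -/
theorem bijOn_partSeq_add (N : ℕ) (hN : 1 ≤ N) (A : Finset ℕ) (n : ℕ) :
    Set.BijOn (fun q : Multiset ℕ × Multiset ℕ => partsOf (partSeq q.1 + (2 * N) • partSeq q.2))
      {q | (q.1 ∈ smallGapPartitions A N ∧ q.2 ∈ posMultisets) ∧
        q.1.sum + 2 * N * q.2.sum = n}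
      {s | s ∈ admissible A N ∧ s.sum = n} := by
  have hanti (c t : Multiset ℕ) : Antitone (partSeq c + (2 * N) • partSeq t : ℕ →₀ ℕ) :=
    fun i j hij => by
      simpa using Nat.add_le_add (partSeq_antitone c hij)
        (Nat.mul_le_mul_left (2 * N) (partSeq_antitone t hij))
  have hmod (x y : ℕ) : x + 2 * N * y ≡ x [MOD 2 * N] := by
    simp [Nat.ModEq]
  refine ⟨?_, ?_, ?_⟩
  · rintro ⟨c, t⟩ ⟨⟨hc, ht⟩, hsum⟩
    simp only at hc ht hsum
    obtain ⟨hc0, hres, hrep⟩ := mem_admissible_iff.1 hc.1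
    refine ⟨mem_admissible_iff.2 ⟨zero_notMem_partsOf _, ?_⟩, ?_⟩
    · simp only [partSeq_partsOf (hanti c t), Finsupp.add_apply, Finsupp.smul_apply, smul_eq_mul]
      refine ⟨fun i => ?_, fun i hi => ?_⟩
      · rcases hres i with h | ⟨a, ha, h⟩
        · exact Or.inl ((hmod _ _).trans h)
        · exact Or.inr ⟨a, ha, (hmod _ _).trans h⟩
      · have h1 := partSeq_antitone c (Nat.le_succ i)
        have h2 := Nat.mul_le_mul_left (2 * N) (partSeq_antitone t (Nat.le_succ i))
        simp only [Nat.succ_eq_add_one] at h1 h2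
        exact dvd_add (hrep i (by omega)) ((dvd_mul_left N 2).mul_right _)
    · simp only [sum_partsOf, map_add, map_nsmul, smul_eq_mul, degree_partSeq hc0,
        degree_partSeq ht, hsum]
  · rintro ⟨c, t⟩ ⟨⟨hc, ht⟩, _⟩ ⟨c', t'⟩ ⟨⟨hc', ht'⟩, _⟩ h
    simp only at h hc hc' ht ht'
    replace h := congrArg partSeq h
    rw [partSeq_partsOf (hanti c t), partSeq_partsOf (hanti c' t')] at h
    have hpt (i : ℕ) : partSeq c i + 2 * N * partSeq t i =
        partSeq c' i + 2 * N * partSeq t' i := by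
      simpa using DFunLike.congr_fun h i
    have hcc : partSeq c = partSeq c' := by
      refine eq_of_smallGap_of_modEq (partSeq_antitone c) (partSeq_antitone c')
        (mem_admissible_iff.1 hc.1).2.2 (mem_admissible_iff.1 hc'.1).2.2 hc.2 hc'.2 fun i => ?_
      exact (hmod _ (partSeq t i)).symm.trans ((hpt i).symm ▸ hmod _ _)
    have htt : partSeq t = partSeq t' := by
      ext i
      have := hpt i
      rw [hcc] at this
      exact Nat.eq_of_mul_eq_mul_left (show 0 < 2 * N by omega) (by omega)
    refine Prod.ext ?_ ?_
    · simpa [partsOf_partSeq hc.1.1, partsOf_partSeq hc'.1.1] using congrArg partsOf hcc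
    · simpa [partsOf_partSeq ht, partsOf_partSeq ht'] using congrArg partsOf htt
  · rintro s ⟨hs, hsum⟩
    obtain ⟨hs0, hres, hrep⟩ := mem_admissible_iff.1 hs
    obtain ⟨u, v, hu, hv, hurep, hugap, huv⟩ :=
      exists_smallGap_add_smul hN (partSeq_antitone s) hrep
    refine ⟨(partsOf u, partsOf v), ⟨⟨⟨mem_admissible_iff.2 ⟨zero_notMem_partsOf _, ?_⟩, ?_⟩,
      zero_notMem_partsOf _⟩, ?_⟩, ?_⟩
    · rw [partSeq_partsOf hu]
      refine ⟨fun i => ?_, hurep⟩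
      have hi : partSeq s i ≡ u i [MOD 2 * N] := by
        rw [huv]
        simp [Nat.ModEq]
      rcases hres i with h | ⟨a, ha, h⟩
      · exact Or.inl (hi.symm.trans h)
      · exact Or.inr ⟨a, ha, hi.symm.trans h⟩
    · rw [partSeq_partsOf hu]
      exact hugap
    · rw [← hsum, ← degree_partSeq hs0, huv]
      simp [sum_partsOf]
    · simp only [partSeq_partsOf hu, partSeq_partsOf hv, ← huv, partsOf_partSeq hs0]

theorem theorem3p2 (N : ℕ) (hN : 1 ≤ N) (A : Finset ℕ)
    (hA : ∀ a ∈ A, 1 ≤ a ∧ a < 2 * N) (n : ℕ) :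
    c1 A n N = c2 A n N := by
  have hZ (i : ℕ) : {t : Multiset ℕ | t ∈ posMultisets ∧ 2 * N * t.sum = i}.Finite := by
    refine (finite_sum_eq posMultisets (fun _ h => h) (i / (2 * N))).subset ?_
    rintro t ⟨ht, rfl⟩
    exact ⟨ht, (Nat.mul_div_cancel_left _ (by omega)).symm⟩
  have hZ0 : {t : Multiset ℕ | t ∈ posMultisets ∧ 2 * N * t.sum = 0}.ncard = 1 := by
    rw [Set.ncard_eq_one]
    refine ⟨0, Set.eq_singleton_iff_unique_mem.2 ⟨⟨Multiset.notMem_zero 0, by simp⟩, ?_⟩⟩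
    rintro t ⟨ht, h⟩
    have hsum : t.sum = 0 := (Nat.mul_eq_zero.1 h).resolve_left (by omega)
    refine Multiset.eq_zero_of_forall_notMem fun x hx => ht ?_
    rwa [Multiset.sum_eq_zero_iff.1 hsum x hx] at hx
  rw [c1_eq_ncard A n N hN, c2_eq_ncard]
  exact ncard_eq_of_ncard_pairs_eq _ _ posMultisets Multiset.sum Multiset.sum
    (fun t => 2 * N * t.sum) (finite_sum_eq _ fun _ hs => hs.1.1) (finite_sum_eq _ fun _ hs => hs.1)
    hZ hZ0 (fun m => (bijOn_partSeq_add N hN A m).ncard_eq.trans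
      (bijOn_add_map N hN A hA m).ncard_eq.symm) n
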